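/- **Theorem (robust completeness).** Let $|\cdot|$ be the infinity norm on $\mathbb{R}^n$, $n\ge 1$, let $\mathcal{W}\subset\mathbb{R}^n$ be a bounded open working space with complement $\mathcal{W}^c$ (the out-of-domain states) and boundary $\partial\mathcal{W}$, and let $\mathcal{U}\subset\mathbb{R}^p$ be compact. Let $f:\mathbb{R}^n\times\mathbb{R}^p\to\mathbb{R}^n$ and $b:\mathbb{R}^n\to\mathbb{R}^{n\times k}$ be locally Lipschitz, let $AP$ be a finite set and $L:\mathbb{R}^n\to 2^{AP}$ a measurable labelling function. Let $0\le\vartheta_1<\vartheta_2$ and consider $$X_{t+1}=f(X_t,u_t)+b(X_t)w_t+\vartheta_i\,\xi^{(i)}_t,\qquad i=1,2,$$ with $w_t\sim\mathcal{N}(0,I_k)$, $|\xi^{(1)}_t|\le 1$ almost surely and $\mathbf{E}|\xi^{(2)}_t|\le 1$; apart from this the joint law of $(w_t,\xi^{(i)}_t)$ is unknown. For $u\in\mathcal{U}$ let $[\![\mathcal{T}^u]\!]_i$ be the set of transition probabilities $\mathcal{T}^u(x,\cdot)=\mathrm{Law}\big(f(x,u)+b(x)w+\vartheta_i\xi\big)$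 obtained from all joint laws of $(w,\xi)$ permitted for system $i$. A boundary modification of $\mathcal{T}$ is a transition probability $\widetilde{\mathcal{T}}$ with * $\widetilde{\mathcal{T}}(x,\Gamma)=\mathcal{T}(x,\Gamma)$ for measurable $\Gamma\subseteq\mathcal{W}$ and $\widetilde{\mathcal{T}}(x,\partial\mathcal{W})=\mathcal{T}(x,\mathcal{W}^c)$, for $x\in\mathcal{W}$; * $\widetilde{\mathcal{T}}(x,\partial\mathcal{W})=1$ for $x\in\partial\mathcal{W}$; * $\widetilde{\mathcal{T}}(x,\mathcal{W})=0$ for $x\notin\mathcal{W}$. Let $\mathbb{XU}_i$ be the controlled Markov system with state space $\mathbb{R}^n$, inputs $\mathcal{U}$, labels $L$ and, for each $u$, the collection $[\![\widetilde{\mathcal{T}}^u]\!]_i$ of all boundary modifications of members of $[\![\mathcal{T}^u]\!]_i$. A rectangle is a product of $n$ intervals, with or without their end points. A rectangular partition of $\mathcal{W}$ is a finite partition of $\mathcal{W}$ into nonempty rectangles. Assume that $L$ is amenable to a rectangular partition: there is a rectangular partition $\{P_1,\dots,P_J\}$ of $\mathcal{W}$ such that $L$ is constant on each $P_i$ and on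 $\mathcal{W}^c$. Then there exist * a mesh size $\eta>0$ and a rectangular partition $\{C_1,\dots,C_N\}$ of $\mathcal{W}$ cut out of $P_1,\dots,P_J$ by the uniform grid of mesh $\eta$, i.e. each $C_j$ is of the form $P_i\cap\{x:\lfloor x/\eta\rfloor=z\}$ with $z\in\mathbb{Z}^n$; with the nodes $\mathcal{Q}=\{q_1,\dots,q_N,q_{N+1}=\Delta\}$ it defines the state-level relation $\alpha\subseteq\mathbb{R}^n\times\mathcal{Q}$ with $\alpha^{-1}(q_j)=C_j$ for $j\le N$ and $\alpha^{-1}(\Delta)=\mathcal{W}^c$; * a measure-level relation $\Sigma_\alpha\subseteq\mathfrak{P}(\mathbb{R}^n)\times\mathfrak{P}(\mathcal{Q})$; * a finite-state abstraction system $\mathbb{IA}=(\mathcal{Q},Act,\{\Theta\},AP,L_{\mathbb{IA}})$ with finite $Act$, whose collections of stochastic matrices are generated by finitely many BMDPs: there are finitely many pairs of families of bounds $\check\Theta^{a,l},\hat\Theta^{a,l}$ with $[\![\Theta^a]\!]=\bigcup_l\{\Theta\text{ stochastic}:\check\Theta^{a,l}\le\Theta\le\hat\Theta^{a,l}\text{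 entrywise}\}$ for all $a\in Act$, such that $\mathbb{XU}_1\preceq_{\Sigma_\alpha}\mathbb{IA}$ and $\mathbb{IA}\preceq_{\Sigma_\alpha^{-1}}\mathbb{XU}_2$, that is: 1. For every $x\in\mathbb{R}^n$ there is $q\in\mathcal{Q}$ with $(x,q)\in\alpha$ and $L_{\mathbb{IA}}(q)=L(x)$. For all $q_i\in\mathcal{Q}$ and $a\in Act$ there is $u\in\mathcal{U}$ such that for every $\widetilde{\mathcal{T}}^u\in[\![\widetilde{\mathcal{T}}^u]\!]_1$ and every $x\in\alpha^{-1}(q_i)$ there is $\Theta^a\in[\![\Theta^a]\!]$ with $(\widetilde{\mathcal{T}}^u(x,\cdot),\Theta^a_i)\in\Sigma_\alpha$ and $\widetilde{\mathcal{T}}^u(x,\alpha^{-1}(q_j))=\Theta^a_{ij}$ for all $j$. 2. For every $q\in\mathcal{Q}$ there is $x\in\mathbb{R}^n$ with $(x,q)\in\alpha$ and $L(x)=L_{\mathbb{IA}}(q)$. For all $q_i\in\mathcal{Q}$ and $u\in\mathcal{U}$ there is $a\in Act$ such that for every $\Theta^a\in[\![\Theta^a]\!]$ and every $x\in\alpha^{-1}(q_i)$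 there is $\widetilde{\mathcal{T}}^u\in[\![\widetilde{\mathcal{T}}^u]\!]_2$ with $(\Theta^a_i,\widetilde{\mathcal{T}}^u(x,\cdot))\in\Sigma_\alpha^{-1}$ and $\Theta^a_{ij}=\widetilde{\mathcal{T}}^u(x,\alpha^{-1}(q_j))$ for all $j$. -/

import Mathlib

open MeasureTheory ProbabilityTheory
open scoped Matrix

/-- `ℝⁿ`; the norm of this type is the infinity norm. -/
abbrev Vec (n : ℕ) : Type := Fin n → ℝ

/-! ### Transition probabilities -/

/-- Transition probabilities (Markov kernels) on a state space. -/
abbrev MarkovKernel (X : Type*) [MeasurableSpace X] : Type _ :=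
  {T : Kernel X X // IsMarkovKernel T}

/-- The probability measure `T(x, ·)`. -/
def MarkovKernel.law {X : Type*} [MeasurableSpace X] (T : MarkovKernel X) (x : X) :
    ProbabilityMeasure X :=
  ⟨T.1 x, T.2.isProbabilityMeasure x⟩

/-- Stochastic matrices indexed by a finite set of nodes. -/
abbrev StochasticMatrix (Q : Type*) [Fintype Q] [DecidableEq Q] : Type _ :=
  {M : Matrix Q Q ℝ // M ∈ Matrix.rowStochastic ℝ Q}

/-- The `i`-th row of a stochastic matrix, as a probability measure on the nodes. -/
noncomputable def StochasticMatrix.rowLaw {Q : Type*} [Fintype Q] [DecidableEq Q]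
    [MeasurableSpace Q] (M : StochasticMatrix Q) (i : Q) : ProbabilityMeasure Q :=
  ⟨∑ j, ENNReal.ofReal (M.1 i j) • Measure.dirac j, ⟨by
    simp only [Measure.coe_finsetSum, Finset.sum_apply, Measure.smul_apply, measure_univ,
      smul_eq_mul, mul_one]
    rw [← ENNReal.ofReal_sum_of_nonneg (fun j _ => M.2.1 i j),
      Matrix.sum_row_of_mem_rowStochastic M.2 i, ENNReal.ofReal_one]⟩⟩

/-! ### Controlled Markov systems and BMDPs -/

/-- A controlled Markov system with states `X`, control inputs `U` and atomic propositions `AP`: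
for every input a collection of transition probabilities, and a measurable labelling function. -/
structure ControlledMarkovSystem (X U AP : Type*) [MeasurableSpace X] where
  trans : U → Set (MarkovKernel X)
  label : X → Set AP
  measurable_label : ∀ A : Set AP, MeasurableSet (label ⁻¹' {A})

/-- A finite-state controlled Markov system with nodes `Q` and actions `Act`: for every action a
collection of stochastic matrices, and a labelling function. -/
structure FiniteMarkovSystem (Q Act AP : Type*) [Fintype Q] [DecidableEq Q] where
  trans : Act → Set (StochasticMatrix Q)
  label : Q → Set AP

/-- A bounded-parameter Markov decision process: for every action, entrywise lower and upper
bounds on the transition matrices. -/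
structure BMDP (Q Act AP : Type*) where
  lower : Act → Matrix Q Q ℝ
  upper : Act → Matrix Q Q ℝ
  label : Q → Set AP

/-- The stochastic matrices lying entrywise between the bounds of a BMDP. -/
def BMDP.trans {Q Act AP : Type*} [Fintype Q] [DecidableEq Q] (B : BMDP Q Act AP) (a : Act) :
    Set (StochasticMatrix Q) :=
  {M | ∀ i j, B.lower a i j ≤ M.1 i j ∧ M.1 i j ≤ B.upper a i j}

/-- The collections of transition matrices of the finite-state system are the unions of those of
finitely many BMDPs on the same nodes, with the same actions and labels. -/
def FiniteMarkovSystem.IsGeneratedByBMDPs {Q Act AP : Type*} [Fintype Q] [DecidableEq Q]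
    (I : FiniteMarkovSystem Q Act AP) : Prop :=
  ∃ (K : ℕ) (B : Fin K → BMDP Q Act AP),
    (∀ l, (B l).label = I.label) ∧ ∀ a, I.trans a = ⋃ l, (B l).trans a

/-! ### Abstraction relations -/

/-- The finite-state system `I` abstracts the system `S` via the state-level relation `α` and the
measure-level relation `R`. Here `α.preimage {q}` is `α⁻¹(q)`. -/
def Abstracts {X U Q Act AP : Type*} [MeasurableSpace X] [Fintype Q] [DecidableEq Q]
    [MeasurableSpace Q] (S : ControlledMarkovSystem X U AP) (I : FiniteMarkovSystem Q Act AP)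
    (α : SetRel X Q) (R : SetRel (ProbabilityMeasure X) (ProbabilityMeasure Q)) : Prop :=
  (∀ x, ∃ q, (x, q) ∈ α ∧ I.label q = S.label x) ∧
  ∀ (i : Q) (a : Act), ∃ u : U, ∀ T ∈ S.trans u, ∀ x ∈ α.preimage {i}, ∃ M ∈ I.trans a,
    (T.law x, M.rowLaw i) ∈ R ∧ ∀ j, (T.1 x).real (α.preimage {j}) = M.1 i j

/-- The converse notion: the system `S` abstracts the finite-state system `I` via a state-level
relation `β` and a measure-level relation `R`, both going from `I` to `S`. Here `β.image {q}` is
the set of states that `β` relates to the node `q`. -/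
def ConverseAbstracts {X U Q Act AP : Type*} [MeasurableSpace X] [Fintype Q] [DecidableEq Q]
    [MeasurableSpace Q] (I : FiniteMarkovSystem Q Act AP) (S : ControlledMarkovSystem X U AP)
    (β : SetRel Q X) (R : SetRel (ProbabilityMeasure Q) (ProbabilityMeasure X)) : Prop :=
  (∀ q, ∃ x, (q, x) ∈ β ∧ S.label x = I.label q) ∧
  ∀ (i : Q) (u : U), ∃ a : Act, ∀ M ∈ I.trans a, ∀ x ∈ β.image {i}, ∃ T ∈ S.trans u,
    (M.rowLaw i, T.law x) ∈ R ∧ ∀ j, M.1 i j = (T.1 x).real (β.image {j})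

/-! ### Rectangular partitions -/

/-- A rectangle: a product of intervals, with or without their end points. -/
def IsRectangle {n : ℕ} (C : Set (Vec n)) : Prop :=
  ∃ J : Fin n → Set ℝ, (∀ d, (J d).OrdConnected) ∧ C = {x | ∀ d, x d ∈ J d}

/-- The cells `C i` are nonempty rectangles and partition `W`. -/
def IsRectPartition {n : ℕ} {ι : Type*} (W : Set (Vec n)) (C : ι → Set (Vec n)) : Prop :=
  (∀ i, IsRectangle (C i) ∧ (C i).Nonempty) ∧ Pairwise (fun i j => Disjoint (C i) (C j)) ∧
    ⋃ i, C i = W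

/-- The labelling function is constant on every cell of a partition of `W`, and constant outside
of `W`. -/
def LabelConstantOn {n : ℕ} {ι AP : Type*} (L : Vec n → Set AP) (W : Set (Vec n))
    (C : ι → Set (Vec n)) : Prop :=
  (∀ i, ∀ x ∈ C i, ∀ y ∈ C i, L x = L y) ∧ ∀ x ∈ Wᶜ, ∀ y ∈ Wᶜ, L x = L y

/-- The cell `{x : ⌊x / η⌋ = z}` of the uniform cubic grid with mesh size `η`. -/
def gridCell {n : ℕ} (η : ℝ) (z : Fin n → ℤ) : Set (Vec n) :=
  {x | ∀ d, ⌊x d / η⌋ = z d}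

/-- The cells `C` are cut out of the cells `P` by the uniform grid of mesh size `η`. -/
def IsUniformRefinement {n : ℕ} {ι ι' : Type*} (P : ι → Set (Vec n)) (η : ℝ)
    (C : ι' → Set (Vec n)) : Prop :=
  ∀ j, ∃ i z, C j = P i ∩ gridCell η z

/-- The state-level relation of a partition of `W` into `N` cells. The nodes are the cells and a
last node `Δ`, which stands for the complement of `W`. -/
def partitionRel {n N : ℕ} (W : Set (Vec n)) (C : Fin N → Set (Vec n)) :
    SetRel (Vec n) (Fin (N + 1)) :=
  {s | (∃ j : Fin N, s.2 = j.castSucc ∧ s.1 ∈ C j) ∨ (s.2 = Fin.last N ∧ s.1 ∈ Wᶜ)}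

/-! ### The stochastic control systems -/

/-- The standard Gaussian law `N(0, I)` on `ℝᵏ`. -/
noncomputable def stdGaussianLaw (k : ℕ) : Measure (Vec k) :=
  Measure.pi fun _ => gaussianReal 0 1

/-- The possible joint laws of `(w, ξ)`, with `w` standard Gaussian and `ξ` in the closed unit ball
of `ℝⁿ`. -/
def boundedNoiseLaws (k n : ℕ) : Set (Measure (Vec k × Vec n)) :=
  {ρ | ρ.map Prod.fst = stdGaussianLaw k ∧ ∀ᵐ z ∂ρ, ‖z.2‖ ≤ 1}

/-- The possible joint laws of `(w, ξ)`, with `w` standard Gaussian and `E|ξ| ≤ 1`. -/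
def integrableNoiseLaws (k n : ℕ) : Set (Measure (Vec k × Vec n)) :=
  {ρ | ρ.map Prod.fst = stdGaussianLaw k ∧ ∫⁻ z, ‖z.2‖ₑ ∂ρ ≤ 1}

/-- The transition probabilities `T(x, ·)` = law of `f(x, u) + b(x) w + ϑ ξ`, the joint law of
`(w, ξ)` being taken from the class `noise`. -/
def perturbedTrans {n p k : ℕ} (f : Vec n → Vec p → Vec n)
    (b : Vec n → Matrix (Fin n) (Fin k) ℝ) (θ : ℝ) (noise : Set (Measure (Vec k × Vec n)))
    (u : Vec p) : Set (MarkovKernel (Vec n)) :=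
  {T | ∃ ρ ∈ noise, ∀ x, T.1 x = ρ.map fun z => f x u + b x *ᵥ z.1 + θ • z.2}

/-- `T'` is a boundary modification of `T` on the working space `W`: it agrees with `T` inside of
`W`, moves the mass that leaves `W` to the boundary of `W`, is absorbed by the boundary, and never
returns to `W`. -/
def IsBoundaryModification {n : ℕ} (W : Set (Vec n)) (T T' : MarkovKernel (Vec n)) : Prop :=
  (∀ x ∈ W, (∀ Γ, MeasurableSet Γ → Γ ⊆ W → T'.1 x Γ = T.1 x Γ) ∧
    T'.1 x (frontier W) = T.1 x Wᶜ) ∧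
  (∀ x ∈ frontier W, T'.1 x (frontier W) = 1) ∧
  ∀ x ∈ Wᶜ, T'.1 x W = 0

/-- The boundary-modified controlled Markov system driven by
`X_{t+1} = f(X_t, u_t) + b(X_t) w_t + ϑ ξ_t`. -/
def modifiedSystem {n p k : ℕ} {AP : Type*} (W : Set (Vec n)) (U : Set (Vec p))
    (f : Vec n → Vec p → Vec n) (b : Vec n → Matrix (Fin n) (Fin k) ℝ) (θ : ℝ)
    (noise : Set (Measure (Vec k × Vec n))) (L : Vec n → Set AP)
    (hL : ∀ A : Set AP, MeasurableSet (L ⁻¹' {A})) : ControlledMarkovSystem (Vec n) U AP where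
  trans u := {T' | ∃ T ∈ perturbedTrans f b θ noise u, IsBoundaryModification W T T'}
  label := L
  measurable_label := hL

/-! On a small grid cell the coefficients `f(·, u)` and `b` are nearly constant, uniformly in `u`.
Fix a state `x` of the cell, an admissible joint law of `(w, ξ)` for the first system, and a row `ν`
close to the resulting law of the next node. Any other state `x'` of the cell can realize `ν` with
the second system: couple the next node from `x` with `ν` so that they disagree with small
probability, send the next state to a representative of the desired node when they do disagree,
leave it alone otherwise, and let `ϑ₂ ξ` be the displacement from `f(x', u) + b(x') w`. Its expected
norm is at most `ϑ₁`, plus the oscillation of the coefficients, plus the cost of the rare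
relocations; the gap `ϑ₂ - ϑ₁` pays for the last two. Only `E|ξ| ≤ 1` survives this construction, as
a relocation can be arbitrarily long.

Hence the rows of the abstraction may be taken from boxes around a finite net of the rows of the
first system, and each action is one of the finitely many patterns of net points that inputs give
rise to. The row of `Δ` tolerates no perturbation, but all its rows are the Dirac mass at `Δ`, so
there a box of radius zero suffices. -/

open scoped ENNReal

/-! ### Couplings and relocation -/

theorem exists_coupling_of_le {X : Type*} [MeasurableSpace X] [MeasurableEq X]
    {l μ ν : Measure X} [IsFiniteMeasure μ] [IsFiniteMeasure ν] (hμν : μ Set.univ = ν Set.univ)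
    (hμ : l ≤ μ) (hν : l ≤ ν) :
    ∃ γ : Measure (X × X), γ.fst = μ ∧ γ.snd = ν ∧ γ {p | p.1 ≠ p.2} ≤ (μ - l) Set.univ := by
  have : IsFiniteMeasure l := isFiniteMeasure_of_le μ hμ
  have hmass : (ν - l) Set.univ = (μ - l) Set.univ := by
    rw [Measure.sub_apply .univ hμ, Measure.sub_apply .univ hν, hμν]
  set D := (μ - l) Set.univ
  have hrescale : ∀ κ : Measure X, κ Set.univ = D → (D⁻¹ * D) • κ = κ := by
    intro κ hκ
    rcases eq_or_ne D 0 with h0 | h0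
    · rw [Measure.measure_univ_eq_zero.1 (hκ.trans h0), smul_zero]
    · rw [ENNReal.inv_mul_cancel h0 (measure_ne_top _ _), one_smul]
  have hdiag : Measurable fun x : X => (x, x) := by fun_prop
  -- The common part `l` sits on the diagonal and the two remainders are coupled independently.
  refine ⟨l.map (fun x => (x, x)) + D⁻¹ • (μ - l).prod (ν - l), ?_, ?_, ?_⟩
  · have hfst : (l.map fun x => (x, x)).fst = l :=
      (Measure.fst_map_prodMk (μ := l) measurable_id).trans Measure.map_id
    rw [Measure.fst_add, hfst, Measure.fst, Measure.map_smul, Measure.map_fst_prod, hmass,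
      smul_smul, hrescale _ rfl, add_comm, Measure.sub_add_cancel_of_le hμ]
  · have hsnd : (l.map fun x => (x, x)).snd = l :=
      (Measure.snd_map_prodMk (μ := l) measurable_id).trans Measure.map_id
    rw [Measure.snd_add, hsnd, Measure.snd, Measure.map_smul, Measure.map_snd_prod,
      smul_smul, hrescale _ hmass, add_comm, Measure.sub_add_cancel_of_le hν]
  · have hoff : MeasurableSet {p : X × X | p.1 ≠ p.2} := measurableSet_diagonal.compl
    calc _ ≤ D⁻¹ * (D * D) := by
            rw [Measure.add_apply, Measure.map_apply hdiag hoff, Measure.smul_apply, smul_eq_mul]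
            simp only [ne_eq, not_true_eq_false, Set.preimage_ofPred_eq, Set.ofPred_false,
              measure_empty, zero_add]
            gcongr
            refine (measure_mono (Set.subset_univ _)).trans_eq ?_
            rw [← Set.univ_prod_univ, Measure.prod_prod, hmass]
      _ ≤ D := by
            rw [← mul_assoc]
            exact mul_le_of_le_one_left zero_le (ENNReal.inv_mul_le_one D)

theorem exists_coupling_of_fintype {X : Type*} [MeasurableSpace X] [MeasurableSingletonClass X]
    [Fintype X] (μ ν : Measure X) [IsProbabilityMeasure μ] [IsProbabilityMeasure ν] :
    ∃ γ : Measure (X × X), γ.fst = μ ∧ γ.snd = ν ∧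
      γ {p | p.1 ≠ p.2} ≤ ∑ x, (μ {x} - ν {x}) := by
  have hinf : ∀ κ : Measure X, (∀ x, min (μ {x}) (ν {x}) ≤ κ {x}) →
      Measure.sum (fun x => min (μ {x}) (ν {x}) • Measure.dirac x) ≤ κ := by
    intro κ hκ
    rw [← Measure.sum_smul_dirac κ]
    refine Measure.le_iff.2 fun s hs => ?_
    simp only [Measure.sum_apply _ hs, Measure.smul_apply, smul_eq_mul]
    gcongr with x
    exact hκ x
  obtain ⟨γ, h₁, h₂, h⟩ := exists_coupling_of_le (by simp) (hinf μ fun _ => min_le_left _ _)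
    (hinf ν fun _ => min_le_right _ _)
  refine ⟨γ, h₁, h₂, h.trans_eq ?_⟩
  have := isFiniteMeasure_of_le μ (hinf μ fun _ => min_le_left _ _)
  rw [← Finset.coe_univ, ← sum_measure_singleton]
  refine Finset.sum_congr rfl fun x _ => ?_
  rw [Measure.sub_apply (measurableSet_singleton x) (hinf μ fun _ => min_le_left _ _),
    Measure.sum_smul_dirac_singleton, tsub_min]

theorem exists_gluing {X Y Z : Type*} [MeasurableSpace X] [MeasurableSpace Y]
    [MeasurableSpace Z] [StandardBorelSpace Y] [Nonempty Y] (ρ : Measure Z) [IsFiniteMeasure ρ]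
    {c : Z → X} (hc : Measurable c) {γ : Measure (X × Y)} [IsFiniteMeasure γ]
    (hγ : γ.fst = ρ.map c) :
    ∃ π : Measure (Z × Y), π.fst = ρ ∧ π.map (Prod.map c id) = γ := by
  refine ⟨ρ ⊗ₘ γ.condKernel.comap c hc, Measure.fst_compProd _ _, ?_⟩
  have hcid : Measurable (Prod.map c (id : Y → Y)) := hc.prodMap measurable_id
  refine Measure.ext_of_lintegral _ fun g hg => ?_
  have hg' : Measurable fun x => ∫⁻ y, g (x, y) ∂γ.condKernel x := hg.lintegral_kernel_prod_right'
  rw [lintegral_map hg hcid, Measure.lintegral_compProd (by fun_prop),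
    ← Measure.lintegral_condKernel hg, hγ, lintegral_map hg' hc]
  rfl

theorem exists_coupling_map_of_fintype {Z X : Type*} [MeasurableSpace Z] [MeasurableSpace X]
    [MeasurableSingletonClass X] [Fintype X] (ρ : Measure Z) [IsProbabilityMeasure ρ] {c : Z → X}
    (hc : Measurable c) (ν : Measure X) [IsProbabilityMeasure ν] :
    ∃ π : Measure (Z × X), π.fst = ρ ∧ π.snd = ν ∧
      π {p | c p.1 ≠ p.2} ≤ ∑ x, (ρ.map c {x} - ν {x}) := by
  have := Measure.isProbabilityMeasure_map (μ := ρ) hc.aemeasurable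
  have : Nonempty X := nonempty_of_isProbabilityMeasure ν
  obtain ⟨γ, hγ₁, hγ₂, hγ⟩ := exists_coupling_of_fintype (ρ.map c) ν
  have : IsFiniteMeasure γ := ⟨by rw [← Measure.fst_univ, hγ₁]; exact measure_lt_top _ _⟩
  obtain ⟨π, hπρ, rfl⟩ := exists_gluing ρ hc hγ₁
  have hcid : Measurable (Prod.map c (id : X → X)) := hc.prodMap measurable_id
  refine ⟨π, hπρ, ?_, ?_⟩
  · rw [← hγ₂, Measure.snd, Measure.snd, Measure.map_map measurable_snd hcid]
    rfl
  · have hoff : MeasurableSet {p : X × X | p.1 ≠ p.2} := measurableSet_diagonal.compl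
    rwa [Measure.map_apply hcid hoff] at hγ

theorem exists_relocation {Z E X : Type*} [MeasurableSpace Z] [PseudoEMetricSpace E]
    [MeasurableSpace E] [OpensMeasurableSpace E] [SecondCountableTopology E] [MeasurableSpace X]
    [MeasurableSingletonClass X] [Fintype X] {ρ : Measure Z} [IsProbabilityMeasure ρ]
    {S Y : Z → E} (hS : Measurable S) (hY : Measurable Y) {c : E → X} (hc : Measurable c)
    {r : X → E} (hr : ∀ x, c (r x) = x) (ν : Measure X) [IsProbabilityMeasure ν]
    {g : Z → ℝ≥0∞} (hg : Measurable g) {D : ℝ≥0∞} (hnear : ∀ᵐ z ∂ρ, edist (S z) (Y z) ≤ g z)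
    (hfar : ∀ x z, edist (r x) (Y z) ≤ D + g z) :
    ∃ π : Measure (Z × E), π.fst = ρ ∧ π.snd.map c = ν ∧
      ∫⁻ p, edist p.2 (Y p.1) ∂π ≤ ∫⁻ z, g z ∂ρ + D * ∑ x, (ρ.map (c ∘ S) {x} - ν {x}) := by
  classical
  obtain ⟨π, rfl, hπν, hπ⟩ := exists_coupling_map_of_fintype ρ (hc.comp hS) ν
  have hrm : Measurable r := measurable_of_countable r
  have hB : MeasurableSet {p : Z × X | (c ∘ S) p.1 ≠ p.2} :=
    (measurableSet_eq_fun (by fun_prop) measurable_snd).compl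
  -- Relocate `S` to the representative of the desired class exactly where the two classes differ.
  set S' : Z × X → E := fun p => if (c ∘ S) p.1 ≠ p.2 then r p.2 else S p.1
  have hS'm : Measurable S' := Measurable.ite hB (by fun_prop) (by fun_prop)
  have hcS' : c ∘ S' = Prod.snd := by
    funext p
    by_cases h : c (S p.1) = p.2 <;> simp [S', h, hr]
  have hbound : ∀ᵐ p ∂π, edist (S' p) (Y p.1) ≤
      {p | (c ∘ S) p.1 ≠ p.2}.indicator (fun _ => D) p + g p.1 := by
    filter_upwards [ae_of_ae_map measurable_fst.aemeasurable hnear] with p hp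
    by_cases h : c (S p.1) = p.2
    · simpa [S', h] using hp
    · simpa [S', h] using hfar p.2 p.1
  refine ⟨π.map fun p => (p.1, S' p), ?_, ?_, ?_⟩
  · exact Measure.fst_map_prodMk hS'm
  · rw [Measure.snd_map_prodMk measurable_fst, Measure.map_map hc hS'm, hcS']
    exact hπν
  · rw [lintegral_map (by fun_prop) (by fun_prop)]
    calc ∫⁻ p, edist (S' p) (Y p.1) ∂π
        ≤ ∫⁻ p, {p | (c ∘ S) p.1 ≠ p.2}.indicator (fun _ => D) p + g p.1 ∂π :=
          lintegral_mono_ae hbound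
      _ = D * π {p | (c ∘ S) p.1 ≠ p.2} + ∫⁻ p, g p.1 ∂π := by
          rw [lintegral_add_left (measurable_const.indicator hB), lintegral_indicator_const hB]
      _ ≤ ∫⁻ z, g z ∂π.fst + D * ∑ x, (π.fst.map (c ∘ S) {x} - ν {x}) := by
          rw [add_comm]
          gcongr
          exact (lintegral_map hg measurable_fst).ge

theorem exists_noise_realizing {Ω E X : Type*} [MeasurableSpace Ω] [NormedAddCommGroup E]
    [NormedSpace ℝ E] [MeasurableSpace E] [BorelSpace E] [SecondCountableTopology E]
    [MeasurableSpace X] [MeasurableSingletonClass X] [Fintype X] {ρ : Measure (Ω × E)}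
    [IsProbabilityMeasure ρ] (hξ : ∀ᵐ z ∂ρ, ‖z.2‖ ≤ 1) {Y₁ Y₂ : Ω → E} (hY₁ : Measurable Y₁)
    (hY₂ : Measurable Y₂) {θ₁ θ₂ : ℝ} (hθ₂ : θ₂ ≠ 0) {c : E → X} (hc : Measurable c) {r : X → E}
    (hr : ∀ x, c (r x) = x) (ν : Measure X) [IsProbabilityMeasure ν] {g : Ω → ℝ≥0∞}
    (hg : Measurable g) {D : ℝ≥0∞} (hnear : ∀ w, edist (Y₁ w) (Y₂ w) ≤ g w)
    (hfar : ∀ x w, edist (r x) (Y₂ w) ≤ D + g w)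
    (hbudget : ‖θ₁‖ₑ + ∫⁻ w, g w ∂ρ.fst +
      D * ∑ x, (ρ.map (fun z => c (Y₁ z.1 + θ₁ • z.2)) {x} - ν {x}) ≤ ‖θ₂‖ₑ) :
    ∃ ρ' : Measure (Ω × E), ρ'.fst = ρ.fst ∧ ∫⁻ z, ‖z.2‖ₑ ∂ρ' ≤ 1 ∧
      ρ'.map (fun z => c (Y₂ z.1 + θ₂ • z.2)) = ν := by
  have hnear' : ∀ᵐ z ∂ρ, edist (Y₁ z.1 + θ₁ • z.2) (Y₂ z.1) ≤ ‖θ₁‖ₑ + g z.1 := by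
    filter_upwards [hξ] with z hz
    have hθξ : ‖θ₁ • z.2‖ₑ ≤ ‖θ₁‖ₑ := enorm_le_iff_norm_le.2 <| by
      simpa [norm_smul] using mul_le_of_le_one_right (abs_nonneg θ₁) hz
    calc edist (Y₁ z.1 + θ₁ • z.2) (Y₂ z.1)
        ≤ edist (Y₁ z.1 + θ₁ • z.2) (Y₁ z.1) + edist (Y₁ z.1) (Y₂ z.1) := edist_triangle _ _ _
      _ ≤ ‖θ₁‖ₑ + g z.1 := by
          rw [edist_eq_enorm_sub, add_sub_cancel_left]
          exact add_le_add hθξ (hnear _)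
  obtain ⟨π, hπρ, hπν, hπ⟩ := exists_relocation (by fun_prop) (by fun_prop) hc hr ν (by fun_prop)
    hnear' fun x z => (hfar x z.1).trans (by gcongr; exact le_add_self)
  have hΦ : Measurable fun p : (Ω × E) × E => (p.1.1, θ₂⁻¹ • (p.2 - Y₂ p.1.1)) := by fun_prop
  refine ⟨π.map fun p => (p.1.1, θ₂⁻¹ • (p.2 - Y₂ p.1.1)), ?_, ?_, ?_⟩
  · rw [Measure.fst_map_prodMk (by fun_prop), ← hπρ, Measure.fst, Measure.fst,
      Measure.map_map measurable_fst measurable_fst]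
    rfl
  · have hcost : ∫⁻ p, edist p.2 (Y₂ p.1.1) ∂π ≤ ‖θ₂‖ₑ := by
      refine hπ.trans (le_of_eq_of_le ?_ hbudget)
      rw [lintegral_add_left measurable_const, lintegral_const, measure_univ, mul_one,
        Measure.fst, lintegral_map hg measurable_fst]
      rfl
    calc ∫⁻ z : Ω × E, ‖z.2‖ₑ ∂π.map _ = ‖θ₂‖ₑ⁻¹ * ∫⁻ p, edist p.2 (Y₂ p.1.1) ∂π := by
          rw [lintegral_map (by fun_prop) hΦ, ← lintegral_const_mul _ (by fun_prop)]
          simp [enorm_smul, enorm_inv hθ₂, edist_eq_enorm_sub]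
      _ ≤ ‖θ₂‖ₑ⁻¹ * ‖θ₂‖ₑ := by gcongr
      _ ≤ 1 := ENNReal.inv_mul_le_one _
  · rw [Measure.map_map (by fun_prop) hΦ, ← hπν, Measure.snd, Measure.map_map hc measurable_snd]
    simp [Function.comp_def, smul_inv_smul₀ hθ₂]

/-! ### Noise laws realizing a perturbed row -/

theorem sum_tsub_singleton_le {Q : Type*} [Fintype Q] [MeasurableSpace Q] {μ ν : Measure Q}
    [IsFiniteMeasure μ] [IsFiniteMeasure ν] {δ : ℝ} (hδ : 0 ≤ δ)
    (h : ∀ q, μ.real {q} ≤ ν.real {q} + δ) :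
    ∑ q, (μ {q} - ν {q}) ≤ ENNReal.ofReal (Fintype.card Q * δ) := by
  have hterm : ∀ q, μ {q} - ν {q} ≤ ENNReal.ofReal δ := by
    intro q
    rw [tsub_le_iff_left, ← ofReal_measureReal, ← ofReal_measureReal,
      ← ENNReal.ofReal_add measureReal_nonneg hδ]
    exact ENNReal.ofReal_le_ofReal (h q)
  refine (Finset.sum_le_card_nsmul _ _ _ fun q _ => hterm q).trans_eq ?_
  rw [Finset.card_univ, nsmul_eq_mul, ENNReal.ofReal_mul (Nat.cast_nonneg _),
    ENNReal.ofReal_natCast]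

section Noise

open scoped Matrix.Norms.Operator

variable {n k : ℕ}

instance isProbabilityMeasure_stdGaussianLaw (k : ℕ) : IsProbabilityMeasure (stdGaussianLaw k) := by
  unfold stdGaussianLaw
  infer_instance

theorem memLp_id_stdGaussianLaw (k : ℕ) : MemLp id 2 (stdGaussianLaw k) :=
  MemLp.of_eval fun i =>
    (memLp_id_gaussianReal 2).comp_measurePreserving
      (measurePreserving_eval (fun _ : Fin k => gaussianReal 0 1) i)

theorem isProbabilityMeasure_of_map_fst_eq_stdGaussianLaw {ρ : Measure (Vec k × Vec n)}
    (hρ : ρ.map Prod.fst = stdGaussianLaw k) : IsProbabilityMeasure ρ := by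
  have : IsProbabilityMeasure (ρ.map Prod.fst) := hρ ▸ inferInstance
  exact Measure.isProbabilityMeasure_of_map (f := Prod.fst)

theorem norm_add_mulVec_le (p : Vec n × Matrix (Fin n) (Fin k) ℝ) (w : Vec k) :
    ‖p.1 + p.2 *ᵥ w‖ ≤ ‖p‖ * (1 + ‖w‖) :=
  calc ‖p.1 + p.2 *ᵥ w‖ ≤ ‖p.1‖ + ‖p.2‖ * ‖w‖ :=
        (norm_add_le _ _).trans (by gcongr; exact Matrix.linfty_opNorm_mulVec _ _)
    _ ≤ ‖p‖ + ‖p‖ * ‖w‖ := by gcongr; exacts [norm_fst_le p, norm_snd_le p]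
    _ = ‖p‖ * (1 + ‖w‖) := by ring

theorem dist_add_mulVec_le (p p' : Vec n × Matrix (Fin n) (Fin k) ℝ) (w : Vec k) :
    dist (p.1 + p.2 *ᵥ w) (p'.1 + p'.2 *ᵥ w) ≤ dist p p' * (1 + ‖w‖) := by
  rw [dist_eq_norm, dist_eq_norm, add_sub_add_comm, ← Matrix.sub_mulVec]
  exact norm_add_mulVec_le (p - p') w

theorem lintegral_ofReal_mul_one_add_norm_sq {κ : ℝ} (hκ : 0 ≤ κ) :
    ∫⁻ w, ENNReal.ofReal (κ * (1 + ‖w‖) ^ 2) ∂stdGaussianLaw k =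
      ENNReal.ofReal (κ * ∫ w, (1 + ‖w‖) ^ 2 ∂stdGaussianLaw k) := by
  have hint : Integrable (fun w : Vec k => (1 + ‖w‖) ^ 2) (stdGaussianLaw k) :=
    ((memLp_const (1 : ℝ)).add (memLp_id_stdGaussianLaw k).norm).integrable_sq
  rw [← integral_const_mul, ofReal_integral_eq_lintegral_ofReal (hint.const_mul κ)
    (.of_forall fun w => by positivity)]

theorem dist_add_mulVec_le_add_mul_sq {κ A R : ℝ} (hκ : 0 < κ)
    {p : Vec n × Matrix (Fin n) (Fin k) ℝ} (hp : ‖p‖ ≤ A) {y : Vec n} (hy : ‖y‖ ≤ R) (w : Vec k) :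
    dist y (p.1 + p.2 *ᵥ w) ≤ R + A ^ 2 / (4 * κ) + κ * (1 + ‖w‖) ^ 2 := by
  -- AM–GM absorbs the linear growth into the quadratic term, whose weight `κ` is at our disposal.
  have hsq : A * (1 + ‖w‖) ≤ A ^ 2 / (4 * κ) + κ * (1 + ‖w‖) ^ 2 := by
    have : 0 ≤ (A - 2 * κ * (1 + ‖w‖)) ^ 2 / (4 * κ) := by positivity
    field_simp at this ⊢
    linarith
  calc dist y (p.1 + p.2 *ᵥ w) ≤ ‖y‖ + ‖p.1 + p.2 *ᵥ w‖ := dist_le_norm_add_norm _ _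
    _ ≤ R + A * (1 + ‖w‖) := by
        gcongr
        exact (norm_add_mulVec_le p w).trans (by gcongr)
    _ ≤ R + A ^ 2 / (4 * κ) + κ * (1 + ‖w‖) ^ 2 := by linarith

theorem exists_integrableNoiseLaw_map_eq {Q : Type*} [Fintype Q] [MeasurableSpace Q]
    [MeasurableSingletonClass Q] {θ₁ θ₂ κ A R δ : ℝ} (hκ : 0 < κ) (hR : 0 ≤ R) (hδ : 0 ≤ δ)
    (hbudget : |θ₁| + κ * ∫ w, (1 + ‖w‖) ^ 2 ∂stdGaussianLaw k +
      (R + A ^ 2 / (4 * κ)) * (Fintype.card Q * δ) ≤ |θ₂|) (hθ₂ : θ₂ ≠ 0)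
    {c : Vec n → Q} (hc : Measurable c) {r : Q → Vec n} (hr : ∀ q, c (r q) = q)
    (hrR : ∀ q, ‖r q‖ ≤ R) {p p' : Vec n × Matrix (Fin n) (Fin k) ℝ} (hpp' : dist p p' ≤ κ)
    (hp' : ‖p'‖ ≤ A) {ρ : Measure (Vec k × Vec n)} (hρ : ρ ∈ boundedNoiseLaws k n)
    (ν : Measure Q) [IsProbabilityMeasure ν]
    (hν : ∀ q, (ρ.map fun z => c (p.1 + p.2 *ᵥ z.1 + θ₁ • z.2)).real {q} ≤ ν.real {q} + δ) :
    ∃ ρ' ∈ integrableNoiseLaws k n,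
      ρ'.map (fun z => c (p'.1 + p'.2 *ᵥ z.1 + θ₂ • z.2)) = ν := by
  have := isProbabilityMeasure_of_map_fst_eq_stdGaussianLaw hρ.1
  have hcost : 0 ≤ R + A ^ 2 / (4 * κ) := by positivity
  have : 0 ≤ ∫ w, (1 + ‖w‖) ^ 2 ∂stdGaussianLaw k := integral_nonneg fun w => by positivity
  have hnear : ∀ w, edist (p.1 + p.2 *ᵥ w) (p'.1 + p'.2 *ᵥ w) ≤
      ENNReal.ofReal (κ * (1 + ‖w‖) ^ 2) := by
    intro w
    rw [edist_dist]
    gcongr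
    calc _ ≤ dist p p' * (1 + ‖w‖) := dist_add_mulVec_le p p' w
      _ ≤ κ * (1 + ‖w‖) ^ 2 := by
          gcongr
          exact le_self_pow₀ (by linarith [norm_nonneg w]) two_ne_zero
  have hfar : ∀ q w, edist (r q) (p'.1 + p'.2 *ᵥ w) ≤
      ENNReal.ofReal (R + A ^ 2 / (4 * κ)) + ENNReal.ofReal (κ * (1 + ‖w‖) ^ 2) := by
    intro q w
    rw [edist_dist, ← ENNReal.ofReal_add hcost (by positivity)]
    gcongr
    exact dist_add_mulVec_le_add_mul_sq hκ hp' (hrR q) w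
  have hfst : ρ.fst = stdGaussianLaw k := hρ.1
  obtain ⟨ρ', hfst', hξ, hmap⟩ := exists_noise_realizing (θ₁ := θ₁) hρ.2 (by fun_prop)
    (by fun_prop) hθ₂ hc hr ν (by fun_prop) hnear hfar <| by
      rw [hfst, lintegral_ofReal_mul_one_add_norm_sq hκ.le]
      refine (add_le_add_right (mul_le_mul_right (sum_tsub_singleton_le hδ hν) _) _).trans ?_
      rw [← ENNReal.ofReal_mul hcost, Real.enorm_eq_ofReal_abs, Real.enorm_eq_ofReal_abs,
        ← ENNReal.ofReal_add (by positivity) (by positivity),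
        ← ENNReal.ofReal_add (by positivity) (by positivity)]
      exact ENNReal.ofReal_le_ofReal hbudget
  exact ⟨ρ', ⟨hfst'.trans hfst, hξ⟩, hmap⟩

theorem exists_rowTolerance {Q : Type*} [Finite Q] [MeasurableSpace Q]
    [MeasurableSingletonClass Q] {θ₁ θ₂ κ : ℝ} (hκ : 0 < κ)
    (hgap : |θ₁| + κ * ∫ w, (1 + ‖w‖) ^ 2 ∂stdGaussianLaw k < |θ₂|) (A : ℝ)
    {c : Vec n → Q} (hc : Measurable c) (hsurj : c.Surjective) :
    ∃ δ > 0, ∀ p p' : Vec n × Matrix (Fin n) (Fin k) ℝ, dist p p' ≤ κ → ‖p'‖ ≤ A →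
      ∀ ρ ∈ boundedNoiseLaws k n, ∀ ν : Measure Q, IsProbabilityMeasure ν →
      (∀ q, (ρ.map fun z => c (p.1 + p.2 *ᵥ z.1 + θ₁ • z.2)).real {q} ≤ ν.real {q} + δ) →
      ∃ ρ' ∈ integrableNoiseLaws k n,
        ρ'.map (fun z => c (p'.1 + p'.2 *ᵥ z.1 + θ₂ • z.2)) = ν := by
  have := Fintype.ofFinite Q
  obtain ⟨r, hr⟩ := hsurj.hasRightInverse
  have hrR : ∀ q, ‖r q‖ ≤ ∑ q, ‖r q‖ := fun q =>
    Finset.single_le_sum (f := fun q => ‖r q‖) (fun _ _ => norm_nonneg _) (Finset.mem_univ q)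
  have : 0 ≤ ∫ w, (1 + ‖w‖) ^ 2 ∂stdGaussianLaw k := integral_nonneg fun w => by positivity
  have hθ₂ : θ₂ ≠ 0 := abs_pos.1 (lt_of_le_of_lt (by positivity) hgap)
  obtain ⟨δ, hδ, hδR⟩ := exists_pos_mul_lt (sub_pos.2 hgap)
    ((∑ q, ‖r q‖ + A ^ 2 / (4 * κ)) * Fintype.card Q)
  exact ⟨δ, hδ, fun p p' hpp' hp' ρ hρ ν _ hν => exists_integrableNoiseLaw_map_eq hκ
    (by positivity) hδ.le (by linarith) hθ₂ hc hr hrR hpp' hp' hρ ν hν⟩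

theorem exists_mesh_of_continuous {X Y E : Type*} [PseudoMetricSpace X] [ProperSpace X]
    [PseudoMetricSpace Y] [SeminormedAddCommGroup E] {F : X × Y → E} (hF : Continuous F) {W : Set X}
    (hW : Bornology.IsBounded W) {U : Set Y} (hU : IsCompact U) {κ : ℝ} (hκ : 0 < κ) :
    ∃ η > 0, ∃ A, (∀ u ∈ U, ∀ x ∈ W, ∀ x' ∈ W, dist x x' < η → dist (F (x, u)) (F (x', u)) ≤ κ) ∧
      ∀ u ∈ U, ∀ x ∈ W, ‖F (x, u)‖ ≤ A := by
  have hK : IsCompact (closure W ×ˢ U) := hW.isCompact_closure.prod hU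
  obtain ⟨η, hη, hunif⟩ := Metric.uniformContinuousOn_iff.1
    (hK.uniformContinuousOn_of_continuous hF.continuousOn) κ hκ
  obtain ⟨A, hA⟩ := hK.exists_bound_of_continuousOn hF.continuousOn
  refine ⟨η, hη, A, fun u hu x hx x' hx' hxx' => ?_, fun u hu x hx =>
    hA _ ⟨subset_closure hx, hu⟩⟩
  refine (hunif _ ⟨subset_closure hx, hu⟩ _ ⟨subset_closure hx', hu⟩ ?_).le
  rwa [Prod.dist_eq, dist_self, max_eq_left dist_nonneg]

variable {p : ℕ} {f : Vec n → Vec p → Vec n} {b : Vec n → Matrix (Fin n) (Fin k) ℝ}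

theorem exists_mem_perturbedTrans {u : Vec p} (hf : Continuous fun x => f x u)
    (hb : Continuous b) (θ : ℝ) {noise : Set (Measure (Vec k × Vec n))}
    {ρ : Measure (Vec k × Vec n)} [IsProbabilityMeasure ρ] (hρ : ρ ∈ noise) :
    ∃ T ∈ perturbedTrans f b θ noise u,
      ∀ x, T.1 x = ρ.map fun z => f x u + b x *ᵥ z.1 + θ • z.2 := by
  have hstep : Measurable fun y : Vec n × Vec k × Vec n =>
      f y.1 u + b y.1 *ᵥ y.2.1 + θ • y.2.2 := by
    refine Continuous.measurable ?_
    fun_prop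
  have hT : ∀ x, (Kernel.id ×ₖ Kernel.const _ ρ).map
      (fun y : Vec n × Vec k × Vec n => f y.1 u + b y.1 *ᵥ y.2.1 + θ • y.2.2) x =
        ρ.map fun z => f x u + b x *ᵥ z.1 + θ • z.2 := by
    intro x
    rw [Kernel.map_apply _ hstep, Kernel.prod_apply, Kernel.id_apply, Kernel.const_apply,
      Measure.dirac_prod, Measure.map_map hstep (by fun_prop)]
    rfl
  exact ⟨⟨_, Kernel.IsMarkovKernel.map _ hstep⟩, ⟨ρ, hρ, hT⟩, hT⟩

theorem exists_mesh_forall_exists_mem_perturbedTrans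
    (hf : Continuous fun z : Vec n × Vec p => f z.1 z.2) (hb : Continuous b) {W : Set (Vec n)}
    (hW : Bornology.IsBounded W) {U : Set (Vec p)} (hU : IsCompact U) {θ₁ θ₂ : ℝ}
    (hθ : |θ₁| < |θ₂|) :
    ∃ η > 0, ∀ {Q : Type} [Finite Q] [MeasurableSpace Q] [MeasurableSingletonClass Q]
      {c : Vec n → Q}, Measurable c → c.Surjective →
      ∃ δ > 0, ∀ u ∈ U, ∀ x ∈ W, ∀ x' ∈ W, dist x x' < η →
        ∀ T ∈ perturbedTrans f b θ₁ (boundedNoiseLaws k n) u,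
        ∀ ν : Measure Q, IsProbabilityMeasure ν →
        (∀ q, ((T.1 x).map c).real {q} ≤ ν.real {q} + δ) →
        ∃ T' ∈ perturbedTrans f b θ₂ (integrableNoiseLaws k n) u, (T'.1 x').map c = ν := by
  obtain ⟨κ, hκ, hκM⟩ := exists_pos_mul_lt (sub_pos.2 hθ)
    (∫ w, (1 + ‖w‖) ^ 2 ∂stdGaussianLaw k)
  have hF : Continuous fun z : Vec n × Vec p => (f z.1 z.2, b z.1) := by fun_prop
  obtain ⟨η, hη, A, hclose, hA⟩ := exists_mesh_of_continuous hF hW hU hκ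
  refine ⟨η, hη, fun {Q} _ _ _ {c} hc hsurj => ?_⟩
  obtain ⟨δ, hδ, hrealize⟩ := exists_rowTolerance (n := n) (θ₁ := θ₁) hκ (by linarith) A hc hsurj
  refine ⟨δ, hδ, ?_⟩
  rintro u hu x hx x' hx' hxx' T ⟨ρ, hρ, hT⟩ ν hν hTν
  have hmap : ∀ (ρ : Measure (Vec k × Vec n)) (θ : ℝ) (y : Vec n),
      (ρ.map fun z => f y u + b y *ᵥ z.1 + θ • z.2).map c =
        ρ.map fun z => c (f y u + b y *ᵥ z.1 + θ • z.2) :=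
    fun ρ θ y => Measure.map_map hc (by fun_prop)
  obtain ⟨ρ', hρ', hmapρ'⟩ := hrealize _ _ (hclose u hu x hx x' hx' hxx') (hA u hu x' hx') ρ hρ
    ν hν (by rwa [hT, hmap] at hTν)
  have : IsProbabilityMeasure ρ' := isProbabilityMeasure_of_map_fst_eq_stdGaussianLaw hρ'.1
  have hfu : Continuous fun x => f x u := hf.comp (Continuous.prodMk_left u)
  obtain ⟨T', hT', hT'ρ'⟩ := exists_mem_perturbedTrans hfu hb θ₂ hρ'
  exact ⟨T', hT', by rw [hT'ρ', hmap, hmapρ']⟩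

end Noise

/-! ### Grid refinements -/

section Partitions

variable {n N : ℕ} {ι ι' : Type*} {W : Set (Vec n)} {η : ℝ}

theorem IsRectangle.measurableSet {C : Set (Vec n)} (h : IsRectangle C) : MeasurableSet C := by
  obtain ⟨J, hJ, rfl⟩ := h
  simp only [Set.ofPred_forall]
  exact MeasurableSet.iInter fun d => measurable_pi_apply d (hJ d).measurableSet

theorem IsRectangle.inter_gridCell {C : Set (Vec n)} (h : IsRectangle C) (hη : 0 < η)
    (z : Fin n → ℤ) : IsRectangle (C ∩ gridCell η z) := by
  obtain ⟨J, hJ, rfl⟩ := h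
  have hfloor : Monotone fun t : ℝ => ⌊t / η⌋ := fun s t hst => Int.floor_mono (by gcongr)
  refine ⟨fun d => J d ∩ (fun t : ℝ => ⌊t / η⌋) ⁻¹' {z d}, fun d =>
    (hJ d).inter (Set.ordConnected_singleton.preimage_mono hfloor), ?_⟩
  ext x
  exact forall_and.symm

theorem dist_lt_of_mem_gridCell (hη : 0 < η) {z : Fin n → ℤ} {x y : Vec n}
    (hx : x ∈ gridCell η z) (hy : y ∈ gridCell η z) : dist x y < η := by
  refine (dist_pi_lt_iff hη).2 fun d => ?_
  have h := Int.abs_sub_lt_one_of_floor_eq_floor ((hx d).trans (hy d).symm)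
  rwa [← sub_div, abs_div, abs_of_pos hη, div_lt_one hη] at h

theorem finite_setOf_inter_gridCell_nonempty {A : Set (Vec n)} (hA : Bornology.IsBounded A)
    (hη : 0 < η) : {z | (A ∩ gridCell η z).Nonempty}.Finite := by
  obtain ⟨r, hr⟩ := hA.exists_norm_le
  refine (Set.Finite.pi' fun _ : Fin n => Set.finite_Icc ⌊-r / η⌋ ⌊r / η⌋).subset ?_
  rintro z ⟨x, hxA, hxz⟩ d
  obtain ⟨hlo, hhi⟩ := abs_le.1 ((norm_le_pi_norm x d).trans (hr x hxA))
  rw [← hxz d]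
  exact ⟨Int.floor_mono (by gcongr), Int.floor_mono (by gcongr)⟩

theorem IsRectPartition.exists_isUniformRefinement [Finite ι] {P : ι → Set (Vec n)}
    (hP : IsRectPartition W P) (hW : Bornology.IsBounded W) (hη : 0 < η) :
    ∃ (N : ℕ) (C : Fin N → Set (Vec n)), IsRectPartition W C ∧ IsUniformRefinement P η C := by
  obtain ⟨hrect, hdisj, rfl⟩ := hP
  have hfin : Finite {s : ι × (Fin n → ℤ) // (P s.1 ∩ gridCell η s.2).Nonempty} := by
    refine (Set.finite_univ.prod (finite_setOf_inter_gridCell_nonempty hW hη)).subset ?_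
    rintro ⟨i, z⟩ h
    exact ⟨Set.mem_univ i, Set.Nonempty.mono (by gcongr; exact Set.subset_iUnion P i) h⟩
  obtain ⟨N, ⟨e⟩⟩ := Finite.exists_equiv_fin {s : ι × (Fin n → ℤ) //
    (P s.1 ∩ gridCell η s.2).Nonempty}
  refine ⟨N, fun j => P (e.symm j).1.1 ∩ gridCell η (e.symm j).1.2, ⟨fun j =>
    ⟨(hrect _).1.inter_gridCell hη _, (e.symm j).2⟩, fun i j hij => ?_, ?_⟩, fun j => ⟨_, _, rfl⟩⟩
  · refine Set.disjoint_left.2 ?_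
    rintro x ⟨hxi, hzi⟩ ⟨hxj, hzj⟩
    refine hij (e.symm.injective (Subtype.ext (Prod.ext ?_ (funext fun d => ?_))))
    · exact hdisj.eq (Set.not_disjoint_iff.2 ⟨x, hxi, hxj⟩)
    · rw [← hzi d, ← hzj d]
  · refine (Set.iUnion_subset fun j => Set.inter_subset_left.trans
      (Set.subset_iUnion P _)).antisymm (Set.iUnion_subset fun i x hx => ?_)
    refine Set.mem_iUnion.2 ⟨e ⟨(i, fun d => ⌊x d / η⌋), x, hx, fun d => rfl⟩, ?_⟩
    rw [e.symm_apply_apply]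
    exact ⟨hx, fun d => rfl⟩

theorem IsUniformRefinement.dist_lt {P : ι → Set (Vec n)} {C : ι' → Set (Vec n)}
    (h : IsUniformRefinement P η C) (hη : 0 < η) {j : ι'} {x y : Vec n} (hx : x ∈ C j)
    (hy : y ∈ C j) : dist x y < η := by
  obtain ⟨i, z, hC⟩ := h j
  rw [hC] at hx hy
  exact dist_lt_of_mem_gridCell hη hx.2 hy.2

theorem LabelConstantOn.of_isUniformRefinement {AP : Type*} {L : Vec n → Set AP}
    {P : ι → Set (Vec n)} {C : ι' → Set (Vec n)} (hL : LabelConstantOn L W P)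
    (h : IsUniformRefinement P η C) : LabelConstantOn L W C := by
  refine ⟨fun j x hx y hy => ?_, hL.2⟩
  obtain ⟨i, z, hC⟩ := h j
  rw [hC] at hx hy
  exact hL.1 i x hx.1 y hy.1

open scoped Classical in
/-- The quotient map of a partition of `W` into cells `C j`: it sends a state to the node of its
cell, and to the last node `Δ` when the state lies in no cell. -/
noncomputable def nodeOf (C : Fin N → Set (Vec n)) (x : Vec n) : Fin (N + 1) :=
  if h : ∃ j, x ∈ C j then h.choose.castSucc else Fin.last N

variable {C : Fin N → Set (Vec n)}

theorem IsRectPartition.nodeOf_eq_castSucc_iff (hC : IsRectPartition W C) {x : Vec n}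
    {j : Fin N} : nodeOf C x = j.castSucc ↔ x ∈ C j := by
  unfold nodeOf
  split_ifs with h
  · rw [Fin.castSucc_inj]
    refine ⟨fun hj => hj ▸ h.choose_spec, fun hj => ?_⟩
    exact hC.2.1.eq (Set.not_disjoint_iff.2 ⟨x, h.choose_spec, hj⟩)
  · exact iff_of_false (Fin.castSucc_lt_last j).ne' fun hj => h ⟨j, hj⟩

theorem IsRectPartition.nodeOf_eq_last_iff (hC : IsRectPartition W C) {x : Vec n} :
    nodeOf C x = Fin.last N ↔ x ∉ W := by
  rw [← hC.2.2, Set.mem_iUnion]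
  unfold nodeOf
  split_ifs with h
  · exact iff_of_false (Fin.castSucc_lt_last _).ne (not_not_intro h)
  · exact iff_of_true rfl h

theorem IsRectPartition.partitionRel_eq_graph (hC : IsRectPartition W C) :
    partitionRel W C = (nodeOf C).graph := by
  ext ⟨x, q⟩
  rw [Function.mem_graph]
  induction q using Fin.lastCases with
  | last => simp [partitionRel, hC.nodeOf_eq_last_iff, (Fin.castSucc_lt_last _).ne']
  | cast j =>
    simp [partitionRel, hC.nodeOf_eq_castSucc_iff, Fin.castSucc_inj, (Fin.castSucc_lt_last _).ne]

theorem IsRectPartition.measurable_nodeOf (hC : IsRectPartition W C) :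
    Measurable (nodeOf C) := by
  have hW : MeasurableSet W :=
    hC.2.2 ▸ MeasurableSet.iUnion fun j => (hC.1 j).1.measurableSet
  refine measurable_to_countable' fun q => ?_
  induction q using Fin.lastCases with
  | last =>
    convert hW.compl using 1
    exact Set.ext fun x => hC.nodeOf_eq_last_iff
  | cast j =>
    convert (hC.1 j).1.measurableSet using 1
    exact Set.ext fun x => hC.nodeOf_eq_castSucc_iff

theorem IsRectPartition.surjective_nodeOf (hC : IsRectPartition W C) (hW : W ≠ Set.univ) :
    (nodeOf C).Surjective := by
  intro q
  induction q using Fin.lastCases with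
  | last =>
    obtain ⟨x, hx⟩ := (Set.ne_univ_iff_exists_notMem W).1 hW
    exact ⟨x, hC.nodeOf_eq_last_iff.2 hx⟩
  | cast j =>
    obtain ⟨x, hx⟩ := (hC.1 j).2
    exact ⟨x, hC.nodeOf_eq_castSucc_iff.2 hx⟩

theorem LabelConstantOn.eq_of_nodeOf_eq {AP : Type*} {L : Vec n → Set AP}
    (hL : LabelConstantOn L W C) (hC : IsRectPartition W C) {x y : Vec n}
    (hxy : nodeOf C x = nodeOf C y) : L x = L y := by
  rcases Fin.eq_castSucc_or_eq_last (nodeOf C y) with ⟨j, hy⟩ | hy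
  · exact hL.1 j x (hC.nodeOf_eq_castSucc_iff.1 (hxy.trans hy)) y (hC.nodeOf_eq_castSucc_iff.1 hy)
  · exact hL.2 x (hC.nodeOf_eq_last_iff.1 (hxy.trans hy)) y (hC.nodeOf_eq_last_iff.1 hy)

end Partitions

/-! ### Boxes around finite nets -/

section FiniteSystems

variable {Q Act AP : Type*} [Fintype Q] [DecidableEq Q]

/-- The finite-state system whose matrices have, for the action `a`, an `i`-th row within `δ i` of
one of the points of `F a i`. It is the abstraction that finite nets `F a i` give rise to. -/
def boxSystem (F : Act → Q → Set (Q → ℝ)) (δ : Q → ℝ) (label : Q → Set AP) :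
    FiniteMarkovSystem Q Act AP where
  trans a := {M | ∀ i, ∃ t ∈ F a i, dist (M.1 i) t ≤ δ i}
  label := label

theorem isGeneratedByBMDPs_boxSystem [Finite Act] {F : Act → Q → Set (Q → ℝ)}
    (hF : ∀ a i, (F a i).Finite) (hne : ∀ a i, (F a i).Nonempty) (δ : Q → ℝ)
    (label : Q → Set AP) : (boxSystem F δ label).IsGeneratedByBMDPs := by
  classical
  have hfin : ∀ a i, Finite (F a i) := hF
  obtain ⟨K, ⟨e⟩⟩ := Finite.exists_equiv_fin (∀ a i, F a i)
  refine ⟨K, fun l => ⟨fun a i j => (e.symm l a i).1 j - δ i,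
    fun a i j => (e.symm l a i).1 j + δ i, label⟩, fun _ => rfl, fun a => ?_⟩
  have hbox : ∀ {i : Q} {s t : Q → ℝ}, dist s t ≤ δ i ↔ ∀ j, t j - δ i ≤ s j ∧ s j ≤ t j + δ i := by
    intro i s t
    have : Nonempty Q := ⟨i⟩
    simp only [dist_pi_le_iff', Real.dist_eq, abs_le, neg_le_sub_iff_le_add, sub_le_iff_le_add,
      add_comm]
  ext M
  simp only [boxSystem, BMDP.trans, hbox, Set.mem_ofPred_eq, Set.mem_iUnion]
  constructor
  · intro hM
    choose t ht hMt using hM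
    let g : ∀ a i, F a i := Function.update (fun a i => ⟨_, (hne a i).some_mem⟩) a
      fun i => ⟨t i, ht i⟩
    exact ⟨e g, by simpa [g] using hMt⟩
  · rintro ⟨l, hl⟩ i
    exact ⟨_, (e.symm l a i).2, hl i⟩

theorem exists_mem_trans_boxSystem_row_eq {F : Act → Q → Set (Q → ℝ)} {δ : Q → ℝ} {a : Act}
    {S : Q → Set (Q → ℝ)} (hS : ∀ i, S i ⊆ stdSimplex ℝ Q) (hne : ∀ i, (S i).Nonempty)
    (hcover : ∀ i, ∀ s ∈ S i, ∃ t ∈ F a i, dist s t ≤ δ i) (label : Q → Set AP) (i : Q)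
    {s : Q → ℝ} (hs : s ∈ S i) : ∃ M ∈ (boxSystem F δ label).trans a, M.1 i = s := by
  let rows : Matrix Q Q ℝ := Function.update (fun i' => (hne i').some) i s
  have hrows : ∀ i', rows i' ∈ S i' :=
    (Function.forall_update_iff _ fun i' r => r ∈ S i').2 ⟨hs, fun i' _ => (hne i').some_mem⟩
  have hstoch : rows ∈ Matrix.rowStochastic ℝ Q := Matrix.mem_rowStochastic_iff_sum.2
    ⟨fun i' => (hS i' (hrows i')).1, fun i' => (hS i' (hrows i')).2⟩
  exact ⟨⟨rows, hstoch⟩, fun i' => hcover i' _ (hrows i'),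
    Function.update_self i s fun i' => (hne i').some⟩

theorem exists_surjective_fin_comp_eq {V Y : Type*} {f : V → Y} (hf : (Set.range f).Finite) :
    ∃ (M : ℕ) (act : V → Fin M) (g : Fin M → Y), act.Surjective ∧ g ∘ act = f := by
  have : Finite (Set.range f) := hf
  obtain ⟨M, ⟨e⟩⟩ := Finite.exists_equiv_fin (Set.range f)
  refine ⟨M, e ∘ Set.rangeFactorization f, fun m => (e.symm m).1,
    e.surjective.comp Set.rangeFactorization_surjective, funext fun v => ?_⟩
  simp

theorem exists_finiteMarkovSystem_rows_approx {V : Type*} {S : V → Q → Set (Q → ℝ)}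
    (hS : ∀ v i, S v i ⊆ stdSimplex ℝ Q) (hne : ∀ v i, (S v i).Nonempty) {N : Q → Set (Q → ℝ)}
    (hN : ∀ i, (N i).Finite) {ε : Q → ℝ} (hcover : ∀ v i, ∀ s ∈ S v i, ∃ t ∈ N i, dist s t ≤ ε i)
    (label : Q → Set AP) :
    ∃ (M : ℕ) (I : FiniteMarkovSystem Q (Fin M) AP) (act : V → Fin M), I.label = label ∧
      I.IsGeneratedByBMDPs ∧ act.Surjective ∧
      (∀ v i, ∀ s ∈ S v i, ∃ A ∈ I.trans (act v), A.1 i = s) ∧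
      ∀ v, ∀ A ∈ I.trans (act v), ∀ i, ∃ s ∈ S v i, dist s (A.1 i) ≤ 2 * ε i := by
  let net : V → Q → Set (Q → ℝ) := fun v i => {t ∈ N i | ∃ s ∈ S v i, dist s t ≤ ε i}
  have hnet_sub : ∀ v i, net v i ⊆ N i := fun v i => Set.sep_subset _ _
  have hnet_cover : ∀ v i, ∀ s ∈ S v i, ∃ t ∈ net v i, dist s t ≤ ε i := fun v i s hs =>
    let ⟨t, ht, hst⟩ := hcover v i s hs
    ⟨t, ⟨ht, s, hs, hst⟩, hst⟩
  have hnet_ne : ∀ v i, (net v i).Nonempty := fun v i =>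
    let ⟨_, hs⟩ := hne v i
    let ⟨t, ht, _⟩ := hnet_cover v i _ hs
    ⟨t, ht⟩
  have hrange : (Set.range net).Finite := (Set.Finite.pi' fun i => (hN i).finite_subsets).subset <|
    Set.range_subset_iff.2 hnet_sub
  obtain ⟨M, act, F, hact, hF⟩ := exists_surjective_fin_comp_eq hrange
  have hF_act : ∀ v, F (act v) = net v := congrFun hF
  refine ⟨M, boxSystem F ε label, act, rfl, isGeneratedByBMDPs_boxSystem ?_ ?_ ε label, hact,
    fun v i s hs => ?_, fun v A hA i => ?_⟩
  · exact hact.forall.2 fun v i => hF_act v ▸ (hN i).subset (hnet_sub v i)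
  · exact hact.forall.2 fun v i => hF_act v ▸ hnet_ne v i
  · exact exists_mem_trans_boxSystem_row_eq (hS v) (hne v) (hF_act v ▸ hnet_cover v) label i hs
  · obtain ⟨t, ht, hAt⟩ := hA i
    rw [hF_act] at ht
    obtain ⟨-, s, hs, hst⟩ := ht
    exact ⟨s, hs, by linarith [dist_triangle_right s (A.1 i) t]⟩

end FiniteSystems

theorem StochasticMatrix.rowLaw_real_singleton {Q : Type*} [Fintype Q] [DecidableEq Q]
    [MeasurableSpace Q] [MeasurableSingletonClass Q] (M : StochasticMatrix Q) (i j : Q) :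
    (M.rowLaw i : Measure Q).real {j} = M.1 i j := by
  have hmass : (M.rowLaw i : Measure Q) {j} = ENNReal.ofReal (M.1 i j) := by
    change (∑ l, ENNReal.ofReal (M.1 i l) • Measure.dirac l) {j} = _
    simp [Measure.coe_finsetSum, Finset.sum_apply, Set.indicator_apply]
  rw [Measure.real, hmass, ENNReal.toReal_ofReal (M.2.1 i j)]

/-! ### Abstractions along a quotient map -/

section Abstractions

instance MarkovKernel.isMarkovKernel {X : Type*} [MeasurableSpace X] (T : MarkovKernel X) :
    IsMarkovKernel T.1 :=
  T.2

/-- The vector of point masses of a measure on a finite type, a point of `stdSimplex` for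
probability measures. It identifies the laws of the next node with rows of stochastic matrices. -/
def massVec {Q : Type*} [MeasurableSpace Q] (ν : Measure Q) : Q → ℝ :=
  fun q => ν.real {q}

section MassVec

variable {Q : Type*} [Fintype Q] [MeasurableSpace Q] [MeasurableSingletonClass Q]

theorem massVec_mem_stdSimplex (ν : Measure Q) [IsProbabilityMeasure ν] :
    massVec ν ∈ stdSimplex ℝ Q :=
  ⟨fun _ => measureReal_nonneg, by
    simp only [massVec, sum_measureReal_singleton, Finset.coe_univ, probReal_univ]⟩

theorem massVec_rowLaw [DecidableEq Q] (M : StochasticMatrix Q) (i : Q) :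
    massVec (M.rowLaw i : Measure Q) = M.1 i :=
  funext (M.rowLaw_real_singleton i)

end MassVec

theorem eq_of_massVec_eq {Q : Type*} [Countable Q] [MeasurableSpace Q] [MeasurableSingletonClass Q]
    {μ ν : Measure Q} [IsFiniteMeasure μ] [IsFiniteMeasure ν] (h : massVec μ = massVec ν) :
    μ = ν :=
  ext_iff_measureReal_singleton.2 (congrFun h)

variable {X V Q AP : Type*} [MeasurableSpace X] [MeasurableSpace Q] {c : X → Q}

/-- The measure-level relation `Σ_α` of the state-level relation `α = c.graph`: a law on the states
is related to its image under the quotient map `c`. -/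
def massRel (c : X → Q) : SetRel (ProbabilityMeasure X) (ProbabilityMeasure Q) :=
  {s | (s.1 : Measure X).map c = s.2}

/-- The laws of the next node, as vectors of point masses, that the system `S` allows under the
input `u` from the states over the node `i`. -/
def ControlledMarkovSystem.nodeRows (S : ControlledMarkovSystem X V AP) (c : X → Q) (u : V)
    (i : Q) : Set (Q → ℝ) :=
  {s | ∃ T ∈ S.trans u, ∃ x, c x = i ∧ massVec ((T.1 x).map c) = s}

/-- Every perturbation of size at most `δ` of a law of the next node that `S₁` allows from some
state over the node `i` is allowed by `S₂`, under the same input, from all states over `i`. -/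
def RealizesPerturbedRows [Fintype Q] (S₁ S₂ : ControlledMarkovSystem X V AP) (c : X → Q) (i : Q)
    (δ : ℝ) : Prop :=
  ∀ u, ∀ s ∈ S₁.nodeRows c u i, ∀ ν : Measure Q, IsProbabilityMeasure ν →
    dist s (massVec ν) ≤ δ → ∀ x, c x = i → ∃ T ∈ S₂.trans u, (T.1 x).map c = ν

variable [MeasurableSingletonClass Q]

section

variable [Fintype Q] [DecidableEq Q] {S : ControlledMarkovSystem X V AP} {Act : Type*}
  {I : FiniteMarkovSystem Q Act AP}

theorem mem_massRel_of_massVec_eq (hc : Measurable c) {T : MarkovKernel X} {x : X}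
    {M : StochasticMatrix Q} {i : Q} (h : massVec ((T.1 x).map c) = M.1 i) :
    (T.law x, M.rowLaw i) ∈ massRel c :=
  have := Measure.isProbabilityMeasure_map (μ := T.1 x) hc.aemeasurable
  eq_of_massVec_eq (h.trans (massVec_rowLaw M i).symm)

theorem abstracts_graph (hc : Measurable c) (hlabel : ∀ x, I.label (c x) = S.label x)
    (h : ∀ i a, ∃ u, ∀ s ∈ S.nodeRows c u i, ∃ M ∈ I.trans a, M.1 i = s) :
    Abstracts S I c.graph (massRel c) := by
  refine ⟨fun x => ⟨c x, rfl, hlabel x⟩, fun i a => ?_⟩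
  obtain ⟨u, hu⟩ := h i a
  refine ⟨u, ?_⟩
  rintro T hT x ⟨_, rfl, rfl : c x = _⟩
  obtain ⟨M, hM, hrow⟩ := hu _ ⟨T, hT, x, rfl, rfl⟩
  refine ⟨M, hM, mem_massRel_of_massVec_eq hc hrow.symm, fun j => ?_⟩
  rw [hrow, massVec, map_measureReal_apply hc (measurableSet_singleton j), Set.preimage_eq]

theorem converseAbstracts_graph_inv (hc : Measurable c) (hsurj : c.Surjective)
    (hlabel : ∀ x, I.label (c x) = S.label x)
    (h : ∀ i u, ∃ a, ∀ M ∈ I.trans a, ∀ x, c x = i →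
      ∃ T ∈ S.trans u, massVec ((T.1 x).map c) = M.1 i) :
    ConverseAbstracts I S c.graph.inv (massRel c).inv := by
  refine ⟨hsurj.forall.2 fun x => ⟨x, rfl, (hlabel x).symm⟩, fun i u => ?_⟩
  obtain ⟨a, ha⟩ := h i u
  refine ⟨a, ?_⟩
  rintro M hM x ⟨_, rfl, rfl : c x = _⟩
  obtain ⟨T, hT, hrow⟩ := ha M hM x rfl
  refine ⟨T, hT, mem_massRel_of_massVec_eq hc hrow, fun j => ?_⟩
  rw [← hrow, massVec, map_measureReal_apply hc (measurableSet_singleton j), SetRel.image_inv,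
    Set.preimage_eq]

end

theorem ControlledMarkovSystem.nodeRows_subset_stdSimplex [Fintype Q]
    (S : ControlledMarkovSystem X V AP) (hc : Measurable c) {u : V} {i : Q} :
    S.nodeRows c u i ⊆ stdSimplex ℝ Q := by
  rintro _ ⟨T, -, x, -, rfl⟩
  have := Measure.isProbabilityMeasure_map (μ := T.1 x) hc.aemeasurable
  exact massVec_mem_stdSimplex _

theorem ControlledMarkovSystem.exists_finite_net_nodeRows [Fintype Q]
    (S : ControlledMarkovSystem X V AP) (hc : Measurable c) {ε : ℝ} (hε : 0 < ε) (i : Q) :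
    ∃ N : Set (Q → ℝ), N.Finite ∧ ∀ u, ∀ s ∈ S.nodeRows c u i, ∃ t ∈ N, dist s t ≤ ε := by
  obtain ⟨N, -, hN, hcover⟩ := (isCompact_stdSimplex ℝ Q).finite_cover_balls hε
  refine ⟨N, hN, fun u s hs => ?_⟩
  obtain ⟨t, ht, hst⟩ := Set.mem_iUnion₂.1 (hcover (S.nodeRows_subset_stdSimplex hc hs))
  exact ⟨t, ht, (Metric.mem_ball.1 hst).le⟩

theorem exists_finite_abstraction [Fintype Q] [DecidableEq Q]
    {S₁ S₂ : ControlledMarkovSystem X V AP} (hc : Measurable c) (hsurj : c.Surjective)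
    (hlabel : ∀ x y, c x = c y → S₁.label x = S₂.label y) (hne : ∀ u, (S₁.trans u).Nonempty)
    (h : ∀ i, ∃ ε, (∃ N : Set (Q → ℝ), N.Finite ∧
      ∀ u, ∀ s ∈ S₁.nodeRows c u i, ∃ t ∈ N, dist s t ≤ ε) ∧
      RealizesPerturbedRows S₁ S₂ c i (2 * ε)) :
    ∃ (M : ℕ) (I : FiniteMarkovSystem Q (Fin M) AP), I.IsGeneratedByBMDPs ∧
      Abstracts S₁ I c.graph (massRel c) ∧ ConverseAbstracts I S₂ c.graph.inv (massRel c).inv := by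
  choose ε hcover hrealize using h
  choose N hN hcover using hcover
  obtain ⟨g, hg⟩ := hsurj.hasRightInverse
  have hrows_ne : ∀ u i, (S₁.nodeRows c u i).Nonempty := fun u i =>
    let ⟨T, hT⟩ := hne u
    ⟨_, T, hT, g i, hg i, rfl⟩
  obtain ⟨M, I, act, hI, hgen, hact, hall, hnear⟩ := exists_finiteMarkovSystem_rows_approx
    (fun u _ => S₁.nodeRows_subset_stdSimplex hc) hrows_ne hN (fun u i => hcover i u)
    fun q => S₁.label (g q)
  have hI₁ : ∀ x, I.label (c x) = S₁.label x := fun x =>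
    (congrFun hI (c x)).trans ((hlabel _ x (hg _)).trans (hlabel x x rfl).symm)
  have hI₂ : ∀ x, I.label (c x) = S₂.label x := fun x => (hI₁ x).trans (hlabel x x rfl)
  refine ⟨M, I, hgen, abstracts_graph hc hI₁ fun i => hact.forall.2 fun u => ⟨u, hall u i⟩,
    converseAbstracts_graph_inv hc hsurj hI₂ fun i u => ⟨act u, fun A hA x hx => ?_⟩⟩
  obtain ⟨s, hs, hsA⟩ := hnear u A hA i
  rw [← massVec_rowLaw] at hsA
  obtain ⟨T, hT, hrow⟩ := hrealize i u s hs _ inferInstance hsA x hx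
  exact ⟨T, hT, by rw [hrow, massVec_rowLaw]⟩

end Abstractions

/-! ### Boundary-modified systems -/

section ModifiedSystems

variable {n p k N : ℕ} {W : Set (Vec n)}

theorem exists_isBoundaryModification (hWo : IsOpen W) (hW : W ≠ Set.univ)
    (T : MarkovKernel (Vec n)) : ∃ T', IsBoundaryModification W T T' := by
  classical
  rcases W.eq_empty_or_nonempty with rfl | hne
  · exact ⟨T, by simp [IsBoundaryModification]⟩
  obtain ⟨y, hy⟩ := nonempty_frontier_iff.2 ⟨hne, hW⟩
  have hdisj : Disjoint (frontier W) W := disjoint_frontier_iff_isOpen.2 hWo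
  have hyW : y ∉ W := hdisj.notMem_of_mem_left hy
  have hφ : Measurable (W.piecewise id fun _ => y) :=
    measurable_id.piecewise hWo.measurableSet measurable_const
  have hφ_sub : ∀ Γ ⊆ W, (W.piecewise id fun _ => y) ⁻¹' Γ = Γ := by
    intro Γ hΓ
    rw [Set.piecewise_preimage, Set.preimage_const_of_notMem fun h => hyW (hΓ h), Set.preimage_id]
    simpa [Set.ite] using hΓ
  have hφ_frontier : (W.piecewise id fun _ => y) ⁻¹' frontier W = Wᶜ := by
    rw [Set.piecewise_preimage, Set.preimage_const_of_mem hy, Set.preimage_id, Set.ite,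
      hdisj.inter_eq, Set.empty_union, Set.compl_eq_univ_sdiff]
  have := Kernel.IsMarkovKernel.map T.1 hφ
  let T' : Kernel (Vec n) (Vec n) := Kernel.piecewise hWo.measurableSet
    (T.1.map (W.piecewise id fun _ => y)) (Kernel.const _ (Measure.dirac y))
  have hT'_mem : ∀ x ∈ W, ∀ s, MeasurableSet s →
      T' x s = T.1 x ((W.piecewise id fun _ => y) ⁻¹' s) := fun x hx s hs => by
    rw [Kernel.piecewise_apply, if_pos hx, Kernel.map_apply' _ hφ _ hs]
  have hT'_notMem : ∀ x ∉ W, T' x = Measure.dirac y := fun x hx => by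
    rw [Kernel.piecewise_apply, if_neg hx, Kernel.const_apply]
  have hfr : MeasurableSet (frontier W) := isClosed_frontier.measurableSet
  refine ⟨⟨T', inferInstanceAs (IsMarkovKernel (Kernel.piecewise _ _ _))⟩,
    fun x hx => ⟨fun Γ hΓ hΓW => ?_, ?_⟩, fun x hx => ?_, fun x hx => ?_⟩
  · rw [hT'_mem x hx Γ hΓ, hφ_sub Γ hΓW]
  · rw [hT'_mem x hx _ hfr, hφ_frontier]
  · rw [hT'_notMem x (hdisj.notMem_of_mem_left hx), Measure.dirac_apply_of_mem hy]
  · rw [hT'_notMem x hx, Measure.dirac_apply' _ hWo.measurableSet, Set.indicator_of_notMem hyW]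

section NodeLaws

variable {C : Fin N → Set (Vec n)} {T T' : MarkovKernel (Vec n)} {x : Vec n}

theorem IsBoundaryModification.map_nodeOf_of_mem (h : IsBoundaryModification W T T')
    (hC : IsRectPartition W C) (hx : x ∈ W) :
    (T'.1 x).map (nodeOf C) = (T.1 x).map (nodeOf C) := by
  have hc := hC.measurable_nodeOf
  have hlast : nodeOf C ⁻¹' {Fin.last N} = Wᶜ := Set.ext fun y => hC.nodeOf_eq_last_iff
  have hW : MeasurableSet W := by
    rw [← compl_compl W, ← hlast]
    exact (hc (measurableSet_singleton _)).compl
  refine Measure.ext_of_singleton fun q => ?_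
  rw [Measure.map_apply hc (measurableSet_singleton q),
    Measure.map_apply hc (measurableSet_singleton q)]
  by_cases hq : q = Fin.last N
  · rw [hq, hlast, prob_compl_eq_one_sub hW, prob_compl_eq_one_sub hW,
      (h.1 x hx).1 W hW subset_rfl]
  · refine (h.1 x hx).1 _ (hc (measurableSet_singleton q)) fun y hy => ?_
    by_contra hyW
    exact hq ((Set.mem_singleton_iff.1 hy).symm.trans (hC.nodeOf_eq_last_iff.2 hyW))

theorem IsBoundaryModification.map_nodeOf_of_notMem (h : IsBoundaryModification W T T')
    (hC : IsRectPartition W C) (hx : x ∉ W) :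
    (T'.1 x).map (nodeOf C) = Measure.dirac (Fin.last N) := by
  have hae : nodeOf C =ᵐ[T'.1 x] fun _ => Fin.last N :=
    (measure_eq_zero_iff_ae_notMem.1 (h.2.2 x hx)).mono fun y => hC.nodeOf_eq_last_iff.2
  rw [Measure.map_congr hae, Measure.map_const, measure_univ, one_smul]

end NodeLaws

theorem prod_dirac_zero_mem_boundedNoiseLaws (k n : ℕ) :
    (stdGaussianLaw k).prod (Measure.dirac (0 : Vec n)) ∈ boundedNoiseLaws k n := by
  refine ⟨by simp [Measure.map_fst_prod], ae_of_ae_map (f := Prod.snd) (p := fun y => ‖y‖ ≤ 1)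
    measurable_snd.aemeasurable ?_⟩
  rw [Measure.map_snd_prod, measure_univ, one_smul,
    ae_dirac_iff (measurableSet_le measurable_norm measurable_const), norm_zero]
  exact zero_le_one

theorem boundedNoiseLaws_subset_integrableNoiseLaws (k n : ℕ) :
    boundedNoiseLaws k n ⊆ integrableNoiseLaws k n := fun ρ hρ => by
  have := isProbabilityMeasure_of_map_fst_eq_stdGaussianLaw hρ.1
  refine ⟨hρ.1, ?_⟩
  calc ∫⁻ z, ‖z.2‖ₑ ∂ρ ≤ ∫⁻ _, 1 ∂ρ :=
        lintegral_mono_ae <| hρ.2.mono fun z hz => by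
          rwa [← ofReal_norm, ENNReal.ofReal_le_one]
    _ = 1 := by rw [lintegral_one, measure_univ]

variable {U : Set (Vec p)} {f : Vec n → Vec p → Vec n} {b : Vec n → Matrix (Fin n) (Fin k) ℝ}
  {AP : Type*} {L : Vec n → Set AP} {hL : ∀ A : Set AP, MeasurableSet (L ⁻¹' {A})}

theorem nonempty_trans_modifiedSystem (hf : Continuous fun z : Vec n × Vec p => f z.1 z.2)
    (hb : Continuous b) (hWo : IsOpen W) (hW : W ≠ Set.univ) (θ : ℝ)
    {noise : Set (Measure (Vec k × Vec n))} (hnoise : boundedNoiseLaws k n ⊆ noise) (u : U) :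
    ((modifiedSystem W U f b θ noise L hL).trans u).Nonempty := by
  have hfu : Continuous fun x => f x u := hf.comp (Continuous.prodMk_left u.1)
  obtain ⟨T, hT, -⟩ := exists_mem_perturbedTrans hfu hb θ
    (hnoise (prod_dirac_zero_mem_boundedNoiseLaws k n))
  obtain ⟨T', hT'⟩ := exists_isBoundaryModification hWo hW T
  exact ⟨T', T, hT, hT'⟩

variable {C : Fin N → Set (Vec n)}

theorem nodeRows_modifiedSystem_last_subset (hC : IsRectPartition W C) (θ : ℝ)
    (noise : Set (Measure (Vec k × Vec n))) (u : U) :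
    (modifiedSystem W U f b θ noise L hL).nodeRows (nodeOf C) u (Fin.last N) ⊆
      {massVec (Measure.dirac (Fin.last N))} := by
  rintro _ ⟨T', ⟨T, -, hT'⟩, x, hx, rfl⟩
  rw [hT'.map_nodeOf_of_notMem hC (hC.nodeOf_eq_last_iff.1 hx), Set.mem_singleton_iff]

theorem realizesPerturbedRows_modifiedSystem_last
    (hf : Continuous fun z : Vec n × Vec p => f z.1 z.2) (hb : Continuous b) (hWo : IsOpen W)
    (hW : W ≠ Set.univ) (hC : IsRectPartition W C) (θ₁ θ₂ : ℝ) :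
    RealizesPerturbedRows (modifiedSystem W U f b θ₁ (boundedNoiseLaws k n) L hL)
      (modifiedSystem W U f b θ₂ (integrableNoiseLaws k n) L hL) (nodeOf C) (Fin.last N) 0 := by
  intro u s hs ν _ hsν x hx
  obtain ⟨T', T, hT, hT'⟩ := nonempty_trans_modifiedSystem (L := L) (hL := hL) hf hb hWo hW θ₂
    (boundedNoiseLaws_subset_integrableNoiseLaws k n) u
  refine ⟨T', ⟨T, hT, hT'⟩, ?_⟩
  rw [hT'.map_nodeOf_of_notMem hC (hC.nodeOf_eq_last_iff.1 hx)]
  rw [dist_le_zero, nodeRows_modifiedSystem_last_subset hC θ₁ _ u hs] at hsν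
  exact eq_of_massVec_eq hsν

theorem exists_mesh_realizesPerturbedRows_modifiedSystem
    (hf : Continuous fun z : Vec n × Vec p => f z.1 z.2) (hb : Continuous b)
    (hWb : Bornology.IsBounded W) (hWo : IsOpen W) (hW : W ≠ Set.univ) (hU : IsCompact U)
    {θ₁ θ₂ : ℝ} (hθ : |θ₁| < |θ₂|) :
    ∃ η > 0, ∀ (N : ℕ) (C : Fin N → Set (Vec n)), IsRectPartition W C →
      (∀ j, ∀ x ∈ C j, ∀ y ∈ C j, dist x y < η) →
      ∃ δ > 0, ∀ j : Fin N,
        RealizesPerturbedRows (modifiedSystem W U f b θ₁ (boundedNoiseLaws k n) L hL)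
          (modifiedSystem W U f b θ₂ (integrableNoiseLaws k n) L hL) (nodeOf C) j.castSucc δ := by
  obtain ⟨η, hη, hrealize⟩ :=
    exists_mesh_forall_exists_mem_perturbedTrans hf hb hWb hU hθ
  refine ⟨η, hη, fun N C hC hsmall => ?_⟩
  obtain ⟨δ, hδ, hδrealize⟩ := hrealize hC.measurable_nodeOf (hC.surjective_nodeOf hW)
  refine ⟨δ, hδ, fun j => ?_⟩
  rintro u _ ⟨T', ⟨T, hT, hT'⟩, x, hx, rfl⟩ ν hν hdist x' hx'
  have hxC := hC.nodeOf_eq_castSucc_iff.1 hx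
  have hx'C := hC.nodeOf_eq_castSucc_iff.1 hx'
  have hCW : C j ⊆ W := hC.2.2 ▸ Set.subset_iUnion C j
  rw [hT'.map_nodeOf_of_mem hC (hCW hxC)] at hdist
  obtain ⟨T₂, hT₂, hmap⟩ := hδrealize u u.2 x (hCW hxC) x' (hCW hx'C) (hsmall j x hxC x' hx'C)
    T hT ν hν fun q => by
      have := (dist_le_pi_dist _ _ q).trans hdist
      rw [Real.dist_eq, abs_le] at this
      exact sub_le_iff_le_add'.1 this.2
  obtain ⟨T₂', hT₂'⟩ := exists_isBoundaryModification hWo hW T₂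
  exact ⟨T₂', ⟨T₂, hT₂, hT₂'⟩, (hT₂'.map_nodeOf_of_mem hC (hCW hx'C)).trans hmap⟩

end ModifiedSystems

theorem mainTheorem2_general {n p k : ℕ} {ι : Type*} [Finite ι] (hn : 0 < n) {AP : Type*}
    (W : Set (Vec n)) (hW : Bornology.IsBounded W) (hWo : IsOpen W)
    (U : Set (Vec p)) (hU : IsCompact U)
    (f : Vec n → Vec p → Vec n) (hf : Continuous fun z : Vec n × Vec p => f z.1 z.2)
    (b : Vec n → Matrix (Fin n) (Fin k) ℝ) (hb : Continuous b)
    (L : Vec n → Set AP) (hL : ∀ A : Set AP, MeasurableSet (L ⁻¹' {A}))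
    (P : ι → Set (Vec n)) (hP : IsRectPartition W P) (hLP : LabelConstantOn L W P)
    (θ₁ θ₂ : ℝ) (hθ : |θ₁| < |θ₂|) :
    ∃ (η : ℝ) (N M : ℕ) (C : Fin N → Set (Vec n))
      (R : SetRel (ProbabilityMeasure (Vec n)) (ProbabilityMeasure (Fin (N + 1))))
      (I : FiniteMarkovSystem (Fin (N + 1)) (Fin M) AP),
      0 < η ∧ IsRectPartition W C ∧ IsUniformRefinement P η C ∧ I.IsGeneratedByBMDPs ∧
      Abstracts (modifiedSystem W U f b θ₁ (boundedNoiseLaws k n) L hL) I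
        (partitionRel W C) R ∧
      ConverseAbstracts I (modifiedSystem W U f b θ₂ (integrableNoiseLaws k n) L hL)
        (partitionRel W C).inv R.inv := by
  have : Nonempty (Fin n) := ⟨⟨0, hn⟩⟩
  have hWuniv : W ≠ Set.univ := fun h => NormedSpace.unbounded_univ ℝ (Vec n) (h ▸ hW)
  obtain ⟨η, hη, hmesh⟩ := exists_mesh_realizesPerturbedRows_modifiedSystem (L := L) (hL := hL)
    hf hb hW hWo hWuniv hU hθ
  obtain ⟨N, C, hC, hPC⟩ := hP.exists_isUniformRefinement hW hη
  obtain ⟨δ, hδ, hcells⟩ := hmesh N C hC fun j x hx y hy => hPC.dist_lt hη hx hy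
  obtain ⟨M, I, hI, habs, hconv⟩ := exists_finite_abstraction
    (S₁ := modifiedSystem W U f b θ₁ (boundedNoiseLaws k n) L hL)
    (S₂ := modifiedSystem W U f b θ₂ (integrableNoiseLaws k n) L hL) hC.measurable_nodeOf
    (hC.surjective_nodeOf hWuniv)
    (fun x y => (hLP.of_isUniformRefinement hPC).eq_of_nodeOf_eq hC)
    (nonempty_trans_modifiedSystem hf hb hWo hWuniv θ₁ subset_rfl) (Fin.lastCases
      ⟨0, ⟨{massVec (Measure.dirac (Fin.last N))}, Set.finite_singleton _, fun u s hs =>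
          ⟨s, nodeRows_modifiedSystem_last_subset hC θ₁ _ u hs, (dist_self s).le⟩⟩,
        by simpa using realizesPerturbedRows_modifiedSystem_last hf hb hWo hWuniv hC θ₁ θ₂⟩
      fun j => ⟨δ / 2, ControlledMarkovSystem.exists_finite_net_nodeRows _ hC.measurable_nodeOf
          (half_pos hδ) _, by simpa [mul_div_cancel₀] using hcells j⟩)
  rw [← hC.partitionRel_eq_graph] at habs hconv
  exact ⟨η, N, M, C, massRel (nodeOf C), I, hη, hC, hPC, hI, habs, hconv⟩

theorem mainTheorem2 {n p k J : ℕ} (hn : 0 < n) {AP : Type*} [Finite AP]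
    (W : Set (Vec n)) (hW : Bornology.IsBounded W) (hWo : IsOpen W)
    (U : Set (Vec p)) (hU : IsCompact U)
    (f : Vec n → Vec p → Vec n) (hf : LocallyLipschitz fun z : Vec n × Vec p => f z.1 z.2)
    (b : Vec n → Matrix (Fin n) (Fin k) ℝ) (hb : ∀ i j, LocallyLipschitz fun x => b x i j)
    (L : Vec n → Set AP) (hL : ∀ A : Set AP, MeasurableSet (L ⁻¹' {A}))
    (P : Fin J → Set (Vec n)) (hP : IsRectPartition W P) (hLP : LabelConstantOn L W P)
    (θ₁ θ₂ : ℝ) (hθ₁ : 0 ≤ θ₁) (hθ : θ₁ < θ₂) :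
    ∃ (η : ℝ) (N M : ℕ) (C : Fin N → Set (Vec n))
      (R : SetRel (ProbabilityMeasure (Vec n)) (ProbabilityMeasure (Fin (N + 1))))
      (I : FiniteMarkovSystem (Fin (N + 1)) (Fin M) AP),
      0 < η ∧ IsRectPartition W C ∧ IsUniformRefinement P η C ∧ I.IsGeneratedByBMDPs ∧
      Abstracts (modifiedSystem W U f b θ₁ (boundedNoiseLaws k n) L hL) I
        (partitionRel W C) R ∧
      ConverseAbstracts I (modifiedSystem W U f b θ₂ (integrableNoiseLaws k n) L hL)
        (partitionRel W C).inv R.inv :=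
  mainTheorem2_general hn W hW hWo U hU f hf.continuous b
    (continuous_matrix fun i j => (hb i j).continuous) L hL P hP hLP θ₁ θ₂
    (by rwa [abs_of_nonneg hθ₁, abs_of_pos (hθ₁.trans_lt hθ)])
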